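/- Bitstrings are elements of $\{0,1\}^*$. A right ideal morphism is a partial function $f$ on $\{0,1\}^*$, with domain ${\rm Dom}(f)$ a finitely generated right ideal of $\{0,1\}^*$, such that $f(xz)=f(x)\,z$ for all $x\in{\rm Dom}(f)$ and $z\in\{0,1\}^*$. An extension $g$ of $f$ to a right ideal morphism is essential if ${\rm Dom}(f)$ meets every nonempty right ideal contained in ${\rm Dom}(g)$; every right ideal morphism has a greatest essential extension, called its maximum extension. The Thompson monoid $M_{2,1}$ consists of the right ideal morphisms that are equal to their maximum extension; its multiplication is composition (right factor applied first) followed by maximum extension. For $u,v\in\{0,1\}^*$ let $[v\leftarrow u]\in M_{2,1}$ be the map $uz\mapsto vz$ ($z\in\{0,1\}^*$) with domain $u\{0,1\}^*$, and let ${\sf id}_u=[u\leftarrow u]$. For $i\ge 1$ let $\tau_{i,i+1}\in M_{2,1}$ be the map that exchanges the $i$-th and the $(i+1)$-st bit of its argument (undefined on strings of length $\le i$), and let $\tau=\{\tau_{i,i+1}:i\ge 1\}$. Let $\Gamma_M$ be any finite generating set of the monoid $M_{2,1}$, and let $\Gamma$ be $\Gamma_M$ or $\Gamma_M\cup\tau$.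 For a word $w\in\Gamma^*$ let $E_w\in M_{2,1}$ be the product of the letters of $w$. The evaluation problem of $M_{2,1}$ over $\Gamma$ is $$\{(w,x,y)\in\Gamma^*\times\{0,1\}^*\times\{0,1\}^* : E_w(x)=y\}$$ (where $E_w(x)=y$ includes that $E_w(x)$ is defined), and the word problem of $M_{2,1}$ over $\Gamma$ is $\{(u,v)\in\Gamma^*\times\Gamma^* : E_u=E_v\}$. Both are regarded as languages over finite alphabets: the elements of $\Gamma_M$ and the bits are letters, $\tau_{i,i+1}$ is encoded by $a\,b^{i+1}a$ with two further letters $a,b$, and the components of a triple or pair are separated by an additional separator letter. **Proposition 7.1.** For all $g\in M_{2,1}$ and $x,y\in\{0,1\}^*$: $g(x)=y$ if and only if $g\cdot{\sf id}_x=[y\leftarrow x]$ in $M_{2,1}$. The evaluation problem of $M_{2,1}$ over $\Gamma_M$ reduces to the word problem of $M_{2,1}$ over $\Gamma_M$, and the evaluation problem of $M_{2,1}$ over $\Gamma_M\cup\tau$ reduces to the word problem of $M_{2,1}$ over $\Gamma_M\cup\tau$, in both cases by a many-one log-space reduction (a total function $f$ on strings, computable by a deterministic Turing transducer with a two-way read-only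 input tape, a one-way write-only output tape and a work tape of which only $O(\log n)$ cells are used on inputs of length $n$, such that a string $s$ is in the first language if and only if $f(s)$ is in the second). -/

import Mathlib

/-! ## The Thompson monoid `M_{2,1}`

Bitstrings are elements of `List Bool`; a partial function on bitstrings is a function into
`Option (List Bool)`, where the value `none` means "undefined". -/

namespace ThompsonMonoid

/-- A right ideal morphism of `{0,1}*`: a partial function `f` on `{0,1}*` with
`f(xw) = f(x)w` for all `x ∈ Dom f` and all `w`, whose domain is a finitely generated right ideal
`P{0,1}*` with `P` finite (equivalently, the domain code of `f` is finite). Neither injectivity nor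
maximality of the domain code or of the image code is required, and the empty function is allowed.
-/
@[ext]
structure RightIdealMorphism where
  toFun : List Bool → Option (List Bool)
  map_append : ∀ x y w, toFun x = some y → toFun (x ++ w) = some (y ++ w)
  finite_dom : ∃ P : Finset (List Bool), ∀ x, (∃ y, toFun x = some y) ↔ ∃ p ∈ P, p <+: x

/-- A set of strings closed under right multiplication and whose elements all have a prefix of
length at most `N` in the set is generated, as a right ideal, by a finite set. -/
theorem exists_finset_of_bound (D : List Bool → Prop) (hD : ∀ x w, D x → D (x ++ w)) (N : ℕ)
    (hN : ∀ x, D x → ∃ p, p <+: x ∧ p.length ≤ N ∧ D p) :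
    ∃ P : Finset (List Bool), ∀ x, D x ↔ ∃ p ∈ P, p <+: x := by
  have hfin : {p : List Bool | p.length ≤ N ∧ D p}.Finite :=
    (List.finite_length_le Bool N).subset fun p hp => hp.1
  refine ⟨hfin.toFinset, fun x => ⟨fun h => ?_, ?_⟩⟩
  · obtain ⟨p, hp, hl, hDp⟩ := hN x h
    exact ⟨p, by simpa using ⟨hl, hDp⟩, hp⟩
  · rintro ⟨p, hp, w, rfl⟩
    have : p.length ≤ N ∧ D p := by simpa using hp
    exact hD p w this.2

namespace RightIdealMorphism

theorem exists_bound (f : RightIdealMorphism) :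
    ∃ N : ℕ, ∀ x y, f.toFun x = some y →
      ∃ p, p <+: x ∧ p.length ≤ N ∧ ∃ v, f.toFun p = some v := by
  obtain ⟨P, hP⟩ := f.finite_dom
  refine ⟨P.sup List.length, fun x y h => ?_⟩
  obtain ⟨p, hp, hpx⟩ := (hP x).1 ⟨y, h⟩
  exact ⟨p, hpx, Finset.le_sup (f := List.length) hp, (hP p).2 ⟨p, hp, List.prefix_refl p⟩⟩

/-- The identity function on `{0,1}*`. -/
def id : RightIdealMorphism where
  toFun x := some x
  map_append := by intro x y w h; simp_all
  finite_dom := ⟨{[]}, by simp⟩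

/-- Composition of partial functions, `(f ∘ g)(x) = f(g(x))`: first `g` is applied, then `f`. -/
def comp (f g : RightIdealMorphism) : RightIdealMorphism where
  toFun x := (g.toFun x).bind f.toFun
  map_append := by
    intro x y w h
    obtain ⟨u, hu, hy⟩ := Option.bind_eq_some_iff.1 h
    rw [g.map_append x u w hu, Option.bind_some]
    exact f.map_append u y w hy
  finite_dom := by
    obtain ⟨N, hN⟩ := f.exists_bound
    obtain ⟨K, hK⟩ := g.exists_bound
    refine exists_finset_of_bound _ ?_ (K + N) ?_
    · rintro x w ⟨y, h⟩
      obtain ⟨u, hu, hy⟩ := Option.bind_eq_some_iff.1 h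
      exact ⟨y ++ w, by
        rw [g.map_append x u w hu, Option.bind_some]; exact f.map_append u y w hy⟩
    · rintro x ⟨y, h⟩
      obtain ⟨u, hu, hy⟩ := Option.bind_eq_some_iff.1 h
      obtain ⟨p, ⟨r, rfl⟩, hpl, v, hv⟩ := hK x u hu
      have huv : u = v ++ r := by
        have := g.map_append p v r hv
        rw [hu] at this
        exact Option.some.inj this
      subst huv
      obtain ⟨q, hq, hql, t, ht⟩ := hN _ y hy
      refine ⟨p ++ r.take N, ?_, ?_, ?_⟩
      · exact (List.prefix_append_right_inj p).2 (List.take_prefix N r)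
      · simp only [List.length_append, List.length_take]; omega
      · have hpre : q <+: v ++ r.take N := by
          refine List.prefix_of_prefix_length_le hq
            ((List.prefix_append_right_inj v).2 (List.take_prefix N r)) ?_
          have h1 : q.length ≤ (v ++ r).length := hq.length_le
          simp only [List.length_append, List.length_take] at h1 ⊢; omega
        obtain ⟨s, hs⟩ := hpre
        refine ⟨t ++ s, ?_⟩
        rw [g.map_append p v _ hv, Option.bind_some, ← hs]
        exact f.map_append q t s ht

/-- `g` is an *essential extension* of `f`: `g` extends `f`, and the right ideal `Dom f` is
essential in `Dom g` (i.e. `Dom f` meets every nonempty right ideal contained in `Dom g`). -/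
def EssentialExtension (f g : RightIdealMorphism) : Prop :=
  (∀ x y, f.toFun x = some y → g.toFun x = some y) ∧
    ∀ x y, g.toFun x = some y → ∃ z v, f.toFun (x ++ z) = some v

/-- `f` is *maximally extended*: it has no essential extension other than itself. -/
def IsMaximal (f : RightIdealMorphism) : Prop :=
  ∀ g, f.EssentialExtension g → g = f

theorem EssentialExtension.refl (f : RightIdealMorphism) : f.EssentialExtension f :=
  ⟨fun _ _ h => h, fun x y h => ⟨[], y, by simpa using h⟩⟩

theorem EssentialExtension.trans {f g h : RightIdealMorphism} (h₁ : f.EssentialExtension g)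
    (h₂ : g.EssentialExtension h) : f.EssentialExtension h := by
  refine ⟨fun x y hx => h₂.1 x y (h₁.1 x y hx), fun x y hx => ?_⟩
  obtain ⟨z, v, hz⟩ := h₂.2 x y hx
  obtain ⟨z', v', hz'⟩ := h₁.2 _ _ hz
  exact ⟨z ++ z', v', by simpa using hz'⟩

theorem EssentialExtension.antisymm {f g : RightIdealMorphism} (h₁ : f.EssentialExtension g)
    (h₂ : g.EssentialExtension f) : f = g := by
  ext x y
  exact ⟨h₁.1 x y, h₂.1 x y⟩

theorem EssentialExtension.comp_left {f f' : RightIdealMorphism} (h : f.EssentialExtension f')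
    (g : RightIdealMorphism) : (f.comp g).EssentialExtension (f'.comp g) := by
  constructor
  · intro x y hx
    obtain ⟨u, hu, hy⟩ := Option.bind_eq_some_iff.1 hx
    exact Option.bind_eq_some_iff.2 ⟨u, hu, h.1 u y hy⟩
  · intro x y hx
    obtain ⟨u, hu, hy⟩ := Option.bind_eq_some_iff.1 hx
    obtain ⟨z, v, hz⟩ := h.2 u y hy
    exact ⟨z, v, Option.bind_eq_some_iff.2 ⟨u ++ z, g.map_append x u z hu, hz⟩⟩

theorem EssentialExtension.comp_right {g g' : RightIdealMorphism} (f : RightIdealMorphism)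
    (h : g.EssentialExtension g') : (f.comp g).EssentialExtension (f.comp g') := by
  constructor
  · intro x y hx
    obtain ⟨u, hu, hy⟩ := Option.bind_eq_some_iff.1 hx
    exact Option.bind_eq_some_iff.2 ⟨u, h.1 x u hu, hy⟩
  · intro x y hx
    obtain ⟨u, hu, hy⟩ := Option.bind_eq_some_iff.1 hx
    obtain ⟨z, v, hz⟩ := h.2 x u hu
    have hv : v = u ++ z := by
      have h1 := h.1 _ _ hz
      rw [g'.map_append x u z hu] at h1
      exact (Option.some.inj h1).symm
    exact ⟨z, y ++ z, Option.bind_eq_some_iff.2 ⟨u ++ z, hv ▸ hz, f.map_append u y z hy⟩⟩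

/-- `f(xz) = yz` for all `z` in the maximal prefix code `{0,1}^n`, for some `n`. -/
def ExtendsTo (f : RightIdealMorphism) (x y : List Bool) : Prop :=
  ∃ n : ℕ, ∀ z : List Bool, z.length = n → f.toFun (x ++ z) = some (y ++ z)

theorem ExtendsTo.of_le {f : RightIdealMorphism} {x y : List Bool} {n : ℕ}
    (h : ∀ z : List Bool, z.length = n → f.toFun (x ++ z) = some (y ++ z)) {z : List Bool}
    (hz : n ≤ z.length) : f.toFun (x ++ z) = some (y ++ z) := by
  have h1 := f.map_append _ _ (z.drop n) (h (z.take n) (by simp [hz]))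
  simpa [List.append_assoc] using h1

theorem ExtendsTo.unique {f : RightIdealMorphism} {x y y' : List Bool} (h : f.ExtendsTo x y)
    (h' : f.ExtendsTo x y') : y = y' := by
  obtain ⟨n, hn⟩ := h
  obtain ⟨m, hm⟩ := h'
  have h1 := ExtendsTo.of_le hn (z := List.replicate (n + m) true) (by simp)
  rw [ExtendsTo.of_le hm (z := List.replicate (n + m) true) (by simp)] at h1
  exact (List.append_cancel_right (Option.some.inj h1)).symm

open Classical in
/-- The graph of the maximum essential extension, as a partial function. -/
noncomputable def maxFun (f : RightIdealMorphism) (x : List Bool) : Option (List Bool) :=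
  if h : ∃ y, f.ExtendsTo x y then some h.choose else none

theorem maxFun_eq_some {f : RightIdealMorphism} {x y : List Bool} :
    f.maxFun x = some y ↔ f.ExtendsTo x y := by
  unfold maxFun
  split_ifs with h
  · constructor
    · intro hy
      exact Option.some.inj hy ▸ h.choose_spec
    · intro hy
      exact congrArg some (h.choose_spec.unique hy)
  · exact ⟨fun h' => by simp at h', fun h' => absurd ⟨y, h'⟩ h⟩

/-- The maximum essential extension of a right ideal morphism. The theorems `le_maxExt` and
`maxExt_greatest` show that it is an essential extension, and the greatest one. -/
noncomputable def maxExt (f : RightIdealMorphism) : RightIdealMorphism where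
  toFun := f.maxFun
  map_append := by
    intro x y w h
    obtain ⟨n, hn⟩ := maxFun_eq_some.1 h
    refine maxFun_eq_some.2 ⟨n, fun z hz => ?_⟩
    have := ExtendsTo.of_le hn (z := w ++ z) (by simp; omega)
    simpa [List.append_assoc] using this
  finite_dom := by
    obtain ⟨N, hN⟩ := f.exists_bound
    refine exists_finset_of_bound _ ?_ N ?_
    · rintro x w ⟨y, h⟩
      obtain ⟨n, hn⟩ := maxFun_eq_some.1 h
      refine ⟨y ++ w, maxFun_eq_some.2 ⟨n, fun z hz => ?_⟩⟩
      have := ExtendsTo.of_le hn (z := w ++ z) (by simp; omega)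
      simpa [List.append_assoc] using this
    · rintro x ⟨y, h⟩
      by_cases hx : x.length ≤ N
      · exact ⟨x, List.prefix_refl x, hx, y, h⟩
      · obtain ⟨n, hn⟩ := maxFun_eq_some.1 h
        obtain ⟨p, hp, hpl, v, hv⟩ := hN _ _ (hn (List.replicate n true) (by simp))
        refine ⟨p, ?_, hpl, v, maxFun_eq_some.2 ⟨0, fun z _ => f.map_append p v z hv⟩⟩
        exact List.prefix_of_prefix_length_le hp (List.prefix_append _ _) (by omega)

theorem le_maxExt (f : RightIdealMorphism) : f.EssentialExtension f.maxExt := by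
  constructor
  · intro x y h
    exact maxFun_eq_some.2 ⟨0, fun z _ => f.map_append x y z h⟩
  · intro x y h
    obtain ⟨n, hn⟩ := maxFun_eq_some.1 h
    exact ⟨List.replicate n true, _, hn _ (by simp)⟩

theorem maxExt_greatest {f g : RightIdealMorphism} (h : f.EssentialExtension g) :
    g.EssentialExtension f.maxExt := by
  have key : ∀ x y, g.toFun x = some y → f.maxExt.toFun x = some y := by
    intro x y hx
    obtain ⟨N, hN⟩ := f.exists_bound
    refine maxFun_eq_some.2 ⟨N, fun z hz => ?_⟩
    have hxz := g.map_append x y z hx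
    obtain ⟨z', v, hv⟩ := h.2 _ _ hxz
    obtain ⟨p, hp, hpl, t, ht⟩ := hN _ _ hv
    have hpre : p <+: x ++ z :=
      List.prefix_of_prefix_length_le hp (List.prefix_append _ _) (by simp; omega)
    obtain ⟨s, hs⟩ := hpre
    have hf := f.map_append p t s ht
    rw [hs] at hf
    have hg := h.1 _ _ hf
    rw [hxz] at hg
    rw [hf, ← hg]
  refine ⟨key, fun x y hx => ?_⟩
  obtain ⟨z, v, hz⟩ := f.le_maxExt.2 x y hx
  exact ⟨z, v, h.1 _ _ hz⟩

theorem maxExt_isMaximal (f : RightIdealMorphism) : f.maxExt.IsMaximal := fun _ h =>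
  (maxExt_greatest (f.le_maxExt.trans h)).antisymm h

theorem IsMaximal.maxExt_eq {f : RightIdealMorphism} (h : f.IsMaximal) : f.maxExt = f :=
  h _ f.le_maxExt

theorem EssentialExtension.maxExt_eq {f g : RightIdealMorphism} (h : f.EssentialExtension g) :
    g.maxExt = f.maxExt :=
  (maxExt_greatest (h.trans g.le_maxExt)).antisymm (maxExt_greatest (maxExt_greatest h))

theorem id_isMaximal : id.IsMaximal := fun g h => by
  ext x y
  exact ⟨fun hx => by rw [h.1 x x rfl] at hx; exact hx, fun hx => h.1 x y hx⟩

end RightIdealMorphism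

open RightIdealMorphism

/-- The Thompson monoid `M_{2,1}`: the maximally extended right ideal morphisms of `{0,1}*` with
finitely generated domain. -/
@[ext]
structure M21 where
  toMorphism : RightIdealMorphism
  isMaximal : toMorphism.IsMaximal

namespace M21

/-- The element of `M_{2,1}` represented by a right ideal morphism: its maximum essential
extension. -/
noncomputable def mk' (f : RightIdealMorphism) : M21 := ⟨f.maxExt, f.maxExt_isMaximal⟩

/-- The value `m(x)` (`none` if `x` is not in the domain of `m`). -/
def eval (m : M21) (x : List Bool) : Option (List Bool) := m.toMorphism.toFun x

/-- Multiplication in `M_{2,1}` is composition (the right factor is applied first), followed by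
maximum essential extension; the identity element is the identity function. -/
noncomputable instance : Monoid M21 where
  mul f g := mk' (f.toMorphism.comp g.toMorphism)
  one := ⟨RightIdealMorphism.id, id_isMaximal⟩
  mul_assoc f g h := by
    refine M21.ext ?_
    change ((f.toMorphism.comp g.toMorphism).maxExt.comp h.toMorphism).maxExt =
      (f.toMorphism.comp (g.toMorphism.comp h.toMorphism).maxExt).maxExt
    rw [((le_maxExt (f.toMorphism.comp g.toMorphism)).comp_left h.toMorphism).maxExt_eq,
      ((le_maxExt (g.toMorphism.comp h.toMorphism)).comp_right f.toMorphism).maxExt_eq]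
    congr 1
    ext x y
    simp [comp, Option.bind_assoc]
  one_mul f := by
    refine M21.ext ?_
    change (RightIdealMorphism.id.comp f.toMorphism).maxExt = f.toMorphism
    have : RightIdealMorphism.id.comp f.toMorphism = f.toMorphism := by
      ext x y
      simp [comp, RightIdealMorphism.id]
    rw [this, f.isMaximal.maxExt_eq]
  mul_one f := by
    refine M21.ext ?_
    change (f.toMorphism.comp RightIdealMorphism.id).maxExt = f.toMorphism
    have : f.toMorphism.comp RightIdealMorphism.id = f.toMorphism := by
      ext x y
      simp [comp, RightIdealMorphism.id]
    rw [this, f.isMaximal.maxExt_eq]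

end M21

/-- The right ideal morphism with table `{(u, v)}`: it maps `uz` to `vz` for all `z`, and is
undefined elsewhere. -/
def singleTable (v u : List Bool) : RightIdealMorphism where
  toFun x := if u <+: x then some (v ++ x.drop u.length) else none
  map_append := by
    intro x y w h
    split_ifs at h with hu
    obtain ⟨r, rfl⟩ := hu
    rw [if_pos ((List.prefix_append u r).trans (List.prefix_append _ w))]
    simp at h
    simp [← h, List.append_assoc]
  finite_dom := ⟨{u}, fun x => by by_cases h : u <+: x <;> simp [h]⟩

/-- The element `[v ← u]` of `M_{2,1}`. In particular `[u ← u]` is the restriction `id_u` of the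
identity function to `u{0,1}*`. -/
noncomputable def replacePrefix (v u : List Bool) : M21 := M21.mk' (singleTable v u)

/-- `swapFun j` exchanges the bits in positions `j` and `j + 1`, where positions are counted from
`0`; it is defined on the strings of length at least `j + 2`. -/
def swapFun : ℕ → List Bool → Option (List Bool)
  | 0, c :: d :: v => some (d :: c :: v)
  | j + 1, c :: v => (swapFun j v).map (c :: ·)
  | _, _ => none

theorem swapFun_append (j : ℕ) (x y w : List Bool) (h : swapFun j x = some y) :
    swapFun j (x ++ w) = some (y ++ w) := by
  induction j generalizing x y with
  | zero =>
    match x, h with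
    | c :: d :: v, h => simp [swapFun] at h ⊢; simp [← h]
  | succ j ih =>
    match x, h with
    | c :: v, h =>
      obtain ⟨t, ht, rfl⟩ := Option.map_eq_some_iff.1 h
      simp [swapFun, ih v t ht]

theorem swapFun_dom (j : ℕ) (x : List Bool) :
    (∃ y, swapFun j x = some y) ↔ j + 2 ≤ x.length := by
  induction j generalizing x with
  | zero =>
    match x with
    | [] => simp [swapFun]
    | [c] => simp [swapFun]
    | c :: d :: v => simp [swapFun]
  | succ j ih =>
    match x with
    | [] => simp [swapFun]
    | c :: v =>
      have := ih v
      simp only [swapFun, Option.map_eq_some_iff, List.length_cons]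
      constructor
      · rintro ⟨_, t, ht, _⟩
        have := this.1 ⟨t, ht⟩
        omega
      · intro h
        obtain ⟨t, ht⟩ := this.2 (by omega)
        exact ⟨_, t, ht, rfl⟩

/-- The bit-transposition exchanging positions `j` and `j + 1`, counted from `0`. -/
def swapMorphism (j : ℕ) : RightIdealMorphism where
  toFun := swapFun j
  map_append := swapFun_append j
  finite_dom := by
    refine exists_finset_of_bound _ ?_ (j + 2) ?_
    · rintro x w ⟨y, h⟩
      exact ⟨_, swapFun_append j x y w h⟩
    · intro x h
      have hl := (swapFun_dom j x).1 h
      exact ⟨x.take (j + 2), List.take_prefix _ _, by simp, (swapFun_dom j _).2 (by simp; omega)⟩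

/-- The element `τ_{i,i+1}` of `M_{2,1}`, for `i ≥ 1`, which exchanges the `i`-th and the
`(i + 1)`-st bit, counted from `1`. -/
noncomputable def bitTransposition (i : ℕ+) : M21 := M21.mk' (swapMorphism ((i : ℕ) - 1))

/-! ## Evaluation problem and word problem as formal languages

Let `L` be a set of letters with an interpretation `val : L → M21` and with an encoding
`enc : L → List A` of the letters by strings over a finite alphabet `A`. -/

section Problems

variable {L A : Type}

/-- `E_w`, the element of `M_{2,1}` generated by the word `w`. The rightmost letter of `w` is applied
first. -/
noncomputable def evalWord (val : L → M21) (w : List L) : M21 := (w.map val).prod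

/-- The string over `A` that encodes the word `w`. -/
def encodeWord (enc : L → List A) (w : List L) : List A := w.flatMap enc

/-- The string that encodes a triple `(w, x, y)`. The alphabet is the disjoint union of `A`, the bits
`{0,1}`, and a separator `none`; the triple is written as `w`, separator, `x`, separator, `y`. -/
def encodeTriple (enc : L → List A) (w : List L) (x y : List Bool) : List (Option (A ⊕ Bool)) :=
  (encodeWord enc w).map (fun c => some (Sum.inl c)) ++
    none :: (x.map (fun c => some (Sum.inr c)) ++ none :: y.map (fun c => some (Sum.inr c)))

/-- The string that encodes a pair of words `(u, v)`, over the disjoint union of `A` and a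
separator `none`: it is written as `u`, separator, `v`. -/
def encodePair (enc : L → List A) (u v : List L) : List (Option A) :=
  (encodeWord enc u).map some ++ none :: (encodeWord enc v).map some

/-- The evaluation problem: the set of all (encoded) triples `(w, x, y)` with `E_w(x) = y`, i.e.
such that `E_w(x)` is defined and is equal to `y`. -/
def evaluationProblem (val : L → M21) (enc : L → List A) : Set (List (Option (A ⊕ Bool))) :=
  {s | ∃ w x y, s = encodeTriple enc w x y ∧ (evalWord val w).eval x = some y}

/-- The word problem: the set of all (encoded) pairs of words `(u, v)` with `E_u = E_v`
in `M_{2,1}`. -/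
def wordProblem (val : L → M21) (enc : L → List A) : Set (List (Option A)) :=
  {s | ∃ u v, s = encodePair enc u v ∧ evalWord val u = evalWord val v}

end Problems

/-! ### The letters of a finite generating set, and of a circuit-like generating set -/

/-- Interpretation of the letters in `Γ`. -/
def gammaVal (Γ : Set M21) : Γ → M21 := fun g => g

/-- The elements of a finite set `Γ` are themselves letters of a finite alphabet. -/
def gammaEnc (Γ : Set M21) : Γ → List Γ := fun g => [g]

/-- Two further letters, used to encode the bit-transpositions. -/
inductive TauSymbol
  | a
  | b

instance : Finite TauSymbol :=
  Finite.of_surjective (fun t : Bool => if t then TauSymbol.a else TauSymbol.b) (by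
    rintro (_ | _)
    · exact ⟨true, rfl⟩
    · exact ⟨false, rfl⟩)

/-- Interpretation of the letters in `Γ ∪ τ`, where `τ = {τ_{i,i+1} : i ≥ 1}`. -/
noncomputable def gammaTauVal (Γ : Set M21) : Γ ⊕ ℕ+ → M21 :=
  Sum.elim (fun g => g) bitTransposition

/-- Encoding of the letters in `Γ ∪ τ` over the finite alphabet which is the disjoint union of `Γ`
and `{a, b}`: an element of `Γ` encodes itself, and `τ_{i,i+1}` is encoded by `a b^{i+1} a`. -/
def gammaTauEnc (Γ : Set M21) : Γ ⊕ ℕ+ → List (Γ ⊕ TauSymbol) :=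
  Sum.elim (fun g => [Sum.inl g]) fun i =>
    Sum.inr TauSymbol.a :: (List.replicate ((i : ℕ) + 1) (Sum.inr TauSymbol.b) ++ [Sum.inr TauSymbol.a])

end ThompsonMonoid

/-! ## Log-space computable functions and many-one reductions -/

namespace LogSpace

/-- Contents of a cell of the input tape: a letter, or one of the two end markers. -/
inductive InputCell (A : Type)
  | leftEnd
  | letter (c : A)
  | rightEnd

/-- Head movements. -/
inductive Move
  | left
  | stay
  | right

/-- A deterministic Turing transducer with a two-way read-only input tape, a read-write work tape
and a one-way write-only output tape. In one step, depending on the state and on the two cells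
that are read, the machine either halts (`none`), or goes into a new state, rewrites the work tape
cell, moves the input head, moves the work head, and appends a string to the output. (There are
finitely many transitions when the input alphabet is finite, so this string is of bounded
length.) -/
structure Transducer (A B : Type) where
  State : Type
  WorkSymbol : Type
  finite_state : Finite State
  finite_workSymbol : Finite WorkSymbol
  start : State
  blank : WorkSymbol
  trans : State → InputCell A → WorkSymbol → Option (State × WorkSymbol × Move × Move × List B)

/-- A configuration, for a given input. On the input tape, position `0` carries the left end marker,
positions `1, …, n` carry the input, and position `n + 1` carries the right end marker. The work tape
has cells `0, 1, 2, …`. -/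
structure Config {A B : Type} (M : Transducer A B) where
  state : M.State
  inputPos : ℕ
  work : ℕ → M.WorkSymbol
  workPos : ℕ
  output : List B

/-- The cell of the input tape at the given position. -/
def readInput {A : Type} (s : List A) : ℕ → InputCell A
  | 0 => .leftEnd
  | i + 1 => match s[i]? with
    | some c => .letter c
    | none => .rightEnd

/-- The new head position on a one-way infinite tape (the head stays put if it is told to move left
from position `0`). -/
def Move.apply : Move → ℕ → ℕ
  | .left, i => i - 1
  | .stay, i => i
  | .right, i => i + 1

namespace Transducer

variable {A B : Type} (M : Transducer A B)

/-- The initial configuration. -/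
def init : Config M where
  state := M.start
  inputPos := 0
  work := fun _ => M.blank
  workPos := 0
  output := []

/-- One step of the machine on input `s`; the value `none` means that the machine has halted. The
input head does not move to the right of the right end marker. -/
def step (s : List A) (c : Config M) : Option (Config M) :=
  (M.trans c.state (readInput s c.inputPos) (c.work c.workPos)).map
    fun (q, t, inMove, workMove, out) =>
      { state := q
        inputPos := min (inMove.apply c.inputPos) (s.length + 1)
        work := Function.update c.work c.workPos t
        workPos := workMove.apply c.workPos
        output := c.output ++ out }

/-- On every input `s` the machine halts with output `f s`. -/
def Computes (f : List A → List B) : Prop :=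
  ∀ s, ∃ c : Config M, StateTransition.Reaches (M.step s) M.init c ∧ M.step s c = none ∧
    c.output = f s

/-- The work space is logarithmically bounded: for some constant `k`, the work head
visits only the first `k (⌊log₂ n⌋ + 1)` cells on inputs of length `n`. -/
def UsesLogSpace : Prop :=
  ∃ k : ℕ, ∀ (s : List A) (c : Config M), StateTransition.Reaches (M.step s) M.init c →
    c.workPos < k * (Nat.log 2 s.length + 1)

end Transducer

/-- `f` is a log-space computable total function, for finite alphabets `A` and `B`. -/
def LogSpaceComputable {A B : Type} [Finite A] [Finite B] (f : List A → List B) : Prop :=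
  ∃ M : Transducer A B, M.Computes f ∧ M.UsesLogSpace

/-- There is a many-one log-space reduction from the language `K` over `A` to the
language `L` over `B`. -/
def ManyOneLogSpaceReducible {A B : Type} [Finite A] [Finite B] (K : Set (List A)) (L : Set (List B)) :
    Prop :=
  ∃ f : List A → List B, LogSpaceComputable f ∧ ∀ s, s ∈ K ↔ f s ∈ L

end LogSpace

/-!
By right-ideal equivariance, `g(x) = y` determines `g` on all of `x{0,1}*`, so it says exactly that
`g` composed with `id_x` is `[y ← x]`; conversely the equation in the monoid gives `g(xz) = yz` for
all sufficiently long `z`, and `g(x) = y` follows because `g` is maximally extended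
(`eval_eq_some_iff`).

To turn this into a reduction, `[y ← x]` has to be written as a word over the generators. It
factors as `[y₁ ← ε] ⋯ [yₖ ← ε] [ε ← xₙ] ⋯ [ε ← x₁]`, where only the four elements `[b ← ε]` and
`[ε ← b]` occur, and each of these is a fixed word over a generating set (`evalWord_push_pop`). Hence
`(w, x, y)` is mapped to the pair consisting of `w` followed by the word for `[x ← x]`, and the word
for `[y ← x]`. This only requires passing over `x` twice and over `y` once in each direction, which a
transducer with a two-way input head does without using its work tape (`pairTransducer`).

Strings that are not of the form `w`, separator, `x`, separator, `y` are mapped to strings with at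
least two separators, which encode no pair of words. It is not necessary to check that `w` is the
code of a word: both ways of encoding letters are suffix codes, so `w` followed by the code of a
word is the code of a word only if `w` is (`IsSuffixCode.exists_of_append`).
-/

namespace ThompsonMonoid

open RightIdealMorphism

/-! ### Prefix replacement in `M_{2,1}` -/

theorem M21.mul_mk' (g : M21) (f : RightIdealMorphism) :
    g * M21.mk' f = M21.mk' (g.toMorphism.comp f) :=
  M21.ext (f.le_maxExt.comp_right g.toMorphism).maxExt_eq

theorem M21.mk'_mul_mk' (f g : RightIdealMorphism) :
    M21.mk' f * M21.mk' g = M21.mk' (f.comp g) := by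
  rw [M21.mul_mk']
  exact M21.ext (f.le_maxExt.comp_left g).maxExt_eq

theorem singleTable_append (v u z : List Bool) :
    (singleTable v u).toFun (u ++ z) = some (v ++ z) := by
  simp [singleTable]

theorem singleTable_eq_some {v u x y : List Bool} :
    (singleTable v u).toFun x = some y ↔ ∃ z, x = u ++ z ∧ y = v ++ z := by
  constructor
  · intro h
    by_cases hu : u <+: x
    · obtain ⟨z, rfl⟩ := hu
      rw [singleTable_append] at h
      exact ⟨z, rfl, (Option.some.inj h).symm⟩
    · simp [singleTable, hu] at h
  · rintro ⟨z, rfl, rfl⟩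
    exact singleTable_append v u z

theorem replacePrefix_nil_mul (u v x : List Bool) :
    replacePrefix u [] * replacePrefix v x = replacePrefix (u ++ v) x := by
  refine (M21.mk'_mul_mk' _ _).trans (congrArg M21.mk' ?_)
  ext s t
  simp only [comp, Option.bind_eq_some_iff, singleTable_eq_some]
  constructor
  · rintro ⟨_, ⟨z, rfl, rfl⟩, z', h, rfl⟩
    exact ⟨z, rfl, by simp_all⟩
  · rintro ⟨z, rfl, rfl⟩
    exact ⟨_, ⟨z, rfl, rfl⟩, v ++ z, rfl, by simp⟩

theorem mul_replacePrefix_nil (y x u : List Bool) :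
    replacePrefix y x * replacePrefix [] u = replacePrefix y (u ++ x) := by
  refine (M21.mk'_mul_mk' _ _).trans (congrArg M21.mk' ?_)
  ext s t
  simp only [comp, Option.bind_eq_some_iff, singleTable_eq_some]
  constructor
  · rintro ⟨_, ⟨z, rfl, rfl⟩, z', h, rfl⟩
    exact ⟨z', by simp_all, rfl⟩
  · rintro ⟨z, rfl, rfl⟩
    exact ⟨_, ⟨x ++ z, by simp, rfl⟩, z, by simp, rfl⟩

theorem replacePrefix_nil_nil : replacePrefix [] [] = 1 := by
  have : singleTable [] [] = RightIdealMorphism.id := by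
    ext s t
    simp [singleTable, RightIdealMorphism.id]
  exact M21.ext ((congrArg maxExt this).trans id_isMaximal.maxExt_eq)

theorem eval_eq_some_iff (g : M21) (x y : List Bool) :
    g.eval x = some y ↔ g * replacePrefix x x = replacePrefix y x := by
  rw [replacePrefix, M21.mul_mk']
  constructor
  · intro h
    refine congrArg M21.mk' ?_
    ext s t
    simp only [comp, Option.bind_eq_some_iff, singleTable_eq_some]
    constructor
    · rintro ⟨_, ⟨z, rfl, rfl⟩, ht⟩
      rw [g.toMorphism.map_append x y z h] at ht
      exact ⟨z, rfl, (Option.some.inj ht).symm⟩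
    · rintro ⟨z, rfl, rfl⟩
      exact ⟨_, ⟨z, rfl, rfl⟩, g.toMorphism.map_append x y z h⟩
  · intro h
    have hy : (singleTable y x).maxExt.toFun x = some y :=
      (singleTable y x).le_maxExt.1 x y (by simpa using singleTable_append y x [])
    have hm : (g.toMorphism.comp (singleTable x x)).maxExt = (singleTable y x).maxExt :=
      congrArg M21.toMorphism h
    rw [← hm] at hy
    obtain ⟨n, hn⟩ := maxFun_eq_some.1 hy
    have hg : g.toMorphism.maxExt.toFun x = some y :=
      maxFun_eq_some.2 ⟨n, fun z hz => by simpa [comp, singleTable_append] using hn z hz⟩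
    rwa [g.isMaximal.maxExt_eq] at hg

/-! ### Words for prefix replacements -/

section Words

variable {L A : Type}

theorem evalWord_append (val : L → M21) (u v : List L) :
    evalWord val (u ++ v) = evalWord val u * evalWord val v := by
  simp [evalWord]

theorem encodeWord_append (enc : L → List A) (u v : List L) :
    encodeWord enc (u ++ v) = encodeWord enc u ++ encodeWord enc v := by
  simp [encodeWord]

theorem evalWord_flatMap_push {val : L → M21} {P : Bool → List L}
    (hP : ∀ b, evalWord val (P b) = replacePrefix [b] []) (y : List Bool) :
    evalWord val (y.flatMap P) = replacePrefix y [] := by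
  induction y with
  | nil => simp [evalWord, replacePrefix_nil_nil]
  | cons b y ih => rw [List.flatMap_cons, evalWord_append, hP, ih, replacePrefix_nil_mul]; rfl

/-- The bits of `x` are removed from the first one on, and the rightmost letter of a word acts
first; hence the reversal. -/
theorem evalWord_flatMap_pop {val : L → M21} {Q : Bool → List L}
    (hQ : ∀ b, evalWord val (Q b) = replacePrefix [] [b]) (x : List Bool) :
    evalWord val (x.reverse.flatMap Q) = replacePrefix [] x := by
  induction x with
  | nil => simp [evalWord, replacePrefix_nil_nil]
  | cons b x ih =>
    rw [List.reverse_cons, List.flatMap_append, evalWord_append, ih, List.flatMap_singleton, hQ,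
      mul_replacePrefix_nil]
    rfl

theorem evalWord_push_pop {val : L → M21} {P Q : Bool → List L}
    (hP : ∀ b, evalWord val (P b) = replacePrefix [b] [])
    (hQ : ∀ b, evalWord val (Q b) = replacePrefix [] [b]) (y x : List Bool) :
    evalWord val (y.flatMap P ++ x.reverse.flatMap Q) = replacePrefix y x := by
  rw [evalWord_append, evalWord_flatMap_push hP, evalWord_flatMap_pop hQ, replacePrefix_nil_mul,
    List.append_nil]

/-- `enc` is a suffix code: all code words are nonempty, and no code word is a suffix of another. -/
def IsSuffixCode (enc : L → List A) : Prop :=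
  (∀ l, enc l ≠ []) ∧ ∀ l l' s s', s ++ enc l = s' ++ enc l' → l = l'

/-- A suffix code is decoded from right to left, so a decodable string stays decodable after
removal of a decodable suffix. -/
theorem IsSuffixCode.exists_of_append {enc : L → List A} (h : IsSuffixCode enc) :
    ∀ (u v : List L) (s : List A), s ++ encodeWord enc u = encodeWord enc v →
      ∃ w, s = encodeWord enc w ∧ v = w ++ u := by
  intro u
  induction u using List.reverseRecOn with
  | nil => intro v s hs; exact ⟨v, by simpa [encodeWord] using hs, by simp⟩
  | append_singleton u l ih =>
    intro v s hs
    rw [encodeWord_append, ← List.append_assoc] at hs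
    have hl : encodeWord enc [l] = enc l := by simp [encodeWord]
    rw [hl] at hs
    rcases List.eq_nil_or_concat' v with rfl | ⟨v, l', rfl⟩
    · exact absurd (List.append_eq_nil_iff.1 hs).2 (h.1 l)
    · rw [encodeWord_append, show encodeWord enc [l'] = enc l' by simp [encodeWord]] at hs
      obtain rfl := h.2 _ _ _ _ hs
      obtain ⟨w, hw, rfl⟩ := ih v s (List.append_cancel_right hs)
      exact ⟨w, hw, by simp⟩

theorem IsSuffixCode.injective {enc : L → List A} (h : IsSuffixCode enc) :
    Function.Injective (encodeWord enc) := by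
  intro u v huv
  obtain ⟨w, hw, rfl⟩ := h.exists_of_append u v [] (by simpa using huv)
  cases w with
  | nil => rfl
  | cons l w => exact absurd hw.symm (by simp [encodeWord, h.1 l])

theorem isSuffixCode_gammaEnc (Γ : Set M21) : IsSuffixCode (gammaEnc Γ) := by
  refine ⟨fun l => by simp [gammaEnc], fun l l' s s' h => ?_⟩
  simpa [gammaEnc] using (List.append_inj' h rfl).2

theorem isSuffixCode_gammaTauEnc (Γ : Set M21) : IsSuffixCode (gammaTauEnc Γ) := by
  refine ⟨fun l => by cases l <;> simp [gammaTauEnc], ?_⟩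
  have key : ∀ (m n : ℕ) (s s' : List (Γ ⊕ TauSymbol)),
      List.replicate m (Sum.inr TauSymbol.b) ++ Sum.inr TauSymbol.a :: s =
        List.replicate n (Sum.inr TauSymbol.b) ++ Sum.inr TauSymbol.a :: s' → m = n := by
    intro m
    induction m with
    | zero => rintro (_ | n) s s' h <;> simp [List.replicate_succ] at h ⊢
    | succ m ih =>
      rintro (_ | n) s s' h
      · simp [List.replicate_succ] at h
      · simp only [List.replicate_succ, List.cons_append, List.cons.injEq, true_and] at h
        rw [ih n s s' h]
  rintro (g | i) (g' | i') s s' h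
  · simpa [gammaTauEnc] using (List.append_inj' h rfl).2
  · have := congrArg List.reverse h
    simp [gammaTauEnc] at this
  · have := congrArg List.reverse h
    simp [gammaTauEnc] at this
  · have h' := congrArg List.reverse h
    simp only [gammaTauEnc, Sum.elim_inr, List.reverse_append, List.reverse_cons,
      List.reverse_nil, List.nil_append, List.reverse_replicate, List.cons_append,
      List.append_assoc, List.cons.injEq, true_and] at h'
    have := key _ _ _ _ h'
    exact congrArg Sum.inr (PNat.eq (by omega))

/-! ### Unstructured triples and their images -/

/-- The string `w`, separator, `x`, separator, `y`, where `w` need not encode a word. -/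
def rawTriple (w : List A) (x y : List Bool) : List (Option (A ⊕ Bool)) :=
  w.map (fun c => some (Sum.inl c)) ++
    none :: (x.map (fun c => some (Sum.inr c)) ++ none :: y.map (fun c => some (Sum.inr c)))

theorem append_separator_inj {α : Type} {e : α} {l l' r r' : List α} (hl : e ∉ l) (hl' : e ∉ l')
    (h : l ++ e :: r = l' ++ e :: r') : l = l' ∧ r = r' := by
  induction l generalizing l' with
  | nil => cases l' <;> simp_all
  | cons a l ih =>
    cases l' with
    | nil => exact absurd (List.mem_cons.2 (.inl (List.cons.inj h).1.symm)) hl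
    | cons b l' =>
      simp only [List.mem_cons, not_or] at hl hl'
      simp only [List.cons_append, List.cons.injEq] at h
      obtain ⟨rfl, h⟩ := h
      simpa using ih hl.2 hl'.2 h

theorem rawTriple_inj {w w' : List A} {x x' y y' : List Bool}
    (h : rawTriple w x y = rawTriple w' x' y') : w = w' ∧ x = x' ∧ y = y' := by
  have hA : Function.Injective (fun c : A => (some (Sum.inl c) : Option (A ⊕ Bool))) :=
    fun a b h => by simpa using h
  have hB : Function.Injective (fun c : Bool => (some (Sum.inr c) : Option (A ⊕ Bool))) :=
    fun a b h => by simpa using h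
  unfold rawTriple at h
  obtain ⟨h₁, h'⟩ := append_separator_inj (by simp) (by simp) h
  obtain ⟨h₂, h₃⟩ := append_separator_inj (by simp) (by simp) h'
  exact ⟨hA.list_map h₁, hB.list_map h₂, hB.list_map h₃⟩

/-- The string `u`, separator, `v`, where `u` is `w` followed by the words for `[x ← x]`, and `v` is
the word for `[y ← x]`; the strings `p b` and `q b` encode words for `[b ← ε]` and `[ε ← b]`. -/
def rawPair (p q : Bool → List A) (w : List A) (x y : List Bool) : List (Option A) :=
  (w ++ (x.flatMap p ++ x.reverse.flatMap q)).map some ++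
    none :: (y.flatMap p ++ x.reverse.flatMap q).map some

theorem map_some_separator_inj {u v u' v' : List A}
    (h : u.map some ++ none :: v.map some = u'.map some ++ none :: v'.map some) :
    u = u' ∧ v = v' := by
  obtain ⟨h₁, h₂⟩ := append_separator_inj (by simp) (by simp) h
  exact ⟨(Option.some_injective A).list_map h₁, (Option.some_injective A).list_map h₂⟩

theorem rawTriple_mem_iff {val : L → M21} {enc : L → List A} (henc : IsSuffixCode enc)
    {P Q : Bool → List L} (hP : ∀ b, evalWord val (P b) = replacePrefix [b] [])
    (hQ : ∀ b, evalWord val (Q b) = replacePrefix [] [b]) (w : List A) (x y : List Bool) :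
    rawTriple w x y ∈ evaluationProblem val enc ↔
      rawPair (fun b => encodeWord enc (P b)) (fun b => encodeWord enc (Q b)) w x y ∈
        wordProblem val enc := by
  have hflat : ∀ (R : Bool → List L) (z : List Bool),
      z.flatMap (fun b => encodeWord enc (R b)) = encodeWord enc (z.flatMap R) := by
    intro R z
    simp [encodeWord, List.flatMap_assoc]
  have hpair : rawPair (fun b => encodeWord enc (P b)) (fun b => encodeWord enc (Q b)) w x y =
      (w ++ encodeWord enc (x.flatMap P ++ x.reverse.flatMap Q)).map some ++
        none :: (encodeWord enc (y.flatMap P ++ x.reverse.flatMap Q)).map some := by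
    simp only [rawPair, hflat, encodeWord_append]
  have hiff : ∀ u : List L, (evalWord val u).eval x = some y ↔
      evalWord val (u ++ (x.flatMap P ++ x.reverse.flatMap Q)) =
        evalWord val (y.flatMap P ++ x.reverse.flatMap Q) := by
    intro u
    rw [eval_eq_some_iff, evalWord_append val u, evalWord_push_pop hP hQ, evalWord_push_pop hP hQ]
  rw [hpair]
  constructor
  · rintro ⟨u, x', y', h, he⟩
    obtain ⟨rfl, rfl, rfl⟩ := rawTriple_inj (h : _ = rawTriple _ _ _)
    exact ⟨_, _, by simp only [encodePair, encodeWord_append], (hiff u).1 he⟩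
  · rintro ⟨u, v, h, he⟩
    obtain ⟨h₁, h₂⟩ := map_some_separator_inj h
    obtain rfl := henc.injective h₂
    obtain ⟨u, rfl, rfl⟩ := henc.exists_of_append _ _ _ h₁
    exact ⟨u, x, y, rfl, (hiff u).2 he⟩

/-- A string with two separators does not encode a pair of words. -/
theorem not_mem_wordProblem {val : L → M21} {enc : L → List A}
    (t : List (Option A)) : t ++ [none, none] ∉ wordProblem val enc := by
  classical
  rintro ⟨u, v, h, -⟩
  have := congrArg (List.count none) h
  have h0 : ∀ l : List A, (l.map some).count none = 0 := fun l =>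
    List.count_eq_zero_of_not_mem (by simp)
  simp [encodePair, h0] at this

end Words

end ThompsonMonoid

namespace LogSpace

/-! ### A two-way transducer without work space -/

open ThompsonMonoid

/-- The phases of the computation on `w`, separator, `x`, separator, `y`: `copyWord` writes `w`;
`pushX` and `pushY` write the words for `[x ← ε]` and `[y ← ε]` from left to right; `popX` and
`popLast` write the word for `[ε ← x]` from right to left; `skipX` and `skipY` move the input head
across `x` and `y`; `halt` is entered on malformed input only. -/
inductive Phase
  | start
  | copyWord
  | pushX
  | popX
  | skipX
  | pushY
  | skipY
  | popLast
  | halt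

instance : Finite Phase :=
  Finite.of_injective (fun φ : Phase => (⟨φ.ctorIdx, by cases φ <;> decide⟩ : Fin 9))
    (by intro a b; cases a <;> cases b <;> simp [Phase.ctorIdx])

variable {A : Type}

/-- A two-way finite-state transducer (with a trivial work tape) which turns `rawTriple w x y` into
`rawPair p q w x y`. As soon as the input is found to be malformed, two separators are appended to
the output, which thus does not represent a pair of words. -/
def pairTransducer (p q : Bool → List A) : Transducer (Option (A ⊕ Bool)) (Option A) where
  State := Phase
  WorkSymbol := Unit
  finite_state := inferInstance
  finite_workSymbol := inferInstance
  start := .start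
  blank := ()
  trans φ c _ := match φ, c with
    | .start, _ => some (.copyWord, (), .right, .stay, [])
    | .copyWord, .letter (some (.inl a)) => some (.copyWord, (), .right, .stay, [some a])
    | .copyWord, .letter none => some (.pushX, (), .right, .stay, [])
    | .pushX, .letter (some (.inr b)) => some (.pushX, (), .right, .stay, (p b).map some)
    | .pushX, .letter none => some (.popX, (), .left, .stay, [])
    | .popX, .letter (some (.inr b)) => some (.popX, (), .left, .stay, (q b).map some)
    | .popX, .letter none => some (.skipX, (), .right, .stay, [none])
    | .skipX, .letter (some (.inr _)) => some (.skipX, (), .right, .stay, [])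
    | .skipX, .letter none => some (.pushY, (), .right, .stay, [])
    | .pushY, .letter (some (.inr b)) => some (.pushY, (), .right, .stay, (p b).map some)
    | .pushY, .rightEnd => some (.skipY, (), .left, .stay, [])
    | .skipY, .letter (some (.inr _)) => some (.skipY, (), .left, .stay, [])
    | .skipY, .letter none => some (.popLast, (), .left, .stay, [])
    | .popLast, .letter (some (.inr b)) => some (.popLast, (), .left, .stay, (q b).map some)
    | .popLast, .letter none => none
    | .halt, _ => none
    | _, _ => some (.halt, (), .stay, .stay, [none, none])

namespace pairTransducer

variable (p q : Bool → List A) {s : List (Option (A ⊕ Bool))}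

/-- The configuration with the given phase, position of the input head, and output. -/
def cfg (φ : Phase) (i : ℕ) (o : List (Option A)) : Config (pairTransducer p q) :=
  ⟨φ, i, fun _ => (), 0, o⟩

theorem step_cfg {φ φ' : Phase} {mv : Move} {i j : ℕ} {o o' : List (Option A)}
    (h : (pairTransducer p q).trans φ (readInput s i) () = some (φ', (), mv, .stay, o'))
    (hj : min (mv.apply i) (s.length + 1) = j) :
    StateTransition.Reaches ((pairTransducer p q).step s) (cfg p q φ i o)
      (cfg p q φ' j (o ++ o')) := by
  refine Relation.ReflTransGen.single ?_
  subst hj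
  change (Option.map _ ((pairTransducer p q).trans φ (readInput s i) ())) = _
  rw [h]
  rfl

theorem usesLogSpace : (pairTransducer p q).UsesLogSpace := by
  refine ⟨1, fun s c hc => ?_⟩
  suffices h : c.workPos = 0 by omega
  induction hc with
  | refl => rfl
  | @tail c c' _ hstep ih =>
    obtain ⟨⟨φ, t, m, m', o⟩, ht, rfl⟩ := Option.map_eq_some_iff.1 hstep
    have hm : m' = .stay := by
      clear hstep
      revert ht
      simp only [pairTransducer]
      split <;> intro ht <;> cases ht <;> rfl
    subst hm
    exact ih

theorem readInput_letter {l r : List (Option (A ⊕ Bool))} {c : Option (A ⊕ Bool)} {i : ℕ}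
    (hs : s = l ++ c :: r) (hi : i = l.length + 1) : readInput s i = .letter c := by
  subst hs hi
  simp [readInput]

theorem readInput_end {i : ℕ} (hi : i = s.length + 1) : readInput s i = .rightEnd := by
  subst hi
  simp [readInput]

/-- The machine stays in phase `φ` and moves right across a block `u`, writing `o a` for each letter
`a`. -/
theorem scan_right {α : Type} {g : α → Option (A ⊕ Bool)} {φ : Phase} {o : α → List (Option A)}
    (hφ : ∀ a, (pairTransducer p q).trans φ (.letter (g a)) () = some (φ, (), .right, .stay, o a))
    (u : List α) {l r : List (Option (A ⊕ Bool))} {out : List (Option A)} {i j : ℕ}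
    (hs : s = l ++ (u.map g ++ r)) (hi : i = l.length + 1) (hj : j = l.length + u.length + 1) :
    StateTransition.Reaches ((pairTransducer p q).step s) (cfg p q φ i out)
      (cfg p q φ j (out ++ u.flatMap o)) := by
  induction u generalizing l out i with
  | nil =>
    obtain rfl : i = j := by simp [hi, hj]
    rw [List.flatMap_nil, List.append_nil]
    exact .refl
  | cons a u ih =>
    have h₁ := step_cfg p q (s := s) (o := out) (j := i + 1)
      (by rw [readInput_letter (c := g a) (by simpa using hs) hi]; exact hφ a)
      (by simp [Move.apply, hi, hs])
    have h₂ := ih (l := l ++ [g a]) (out := out ++ o a) (i := i + 1) (by simp [hs]) (by simp [hi])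
      (by simp [hj]; omega)
    have h : StateTransition.Reaches _ _ _ := h₁.trans h₂
    simpa using h

/-- The machine stays in phase `φ` and moves left across a block `u`, writing `o a` for each letter
`a`, from the last one to the first one. -/
theorem scan_left {α : Type} {g : α → Option (A ⊕ Bool)} {φ : Phase} {o : α → List (Option A)}
    (hφ : ∀ a, (pairTransducer p q).trans φ (.letter (g a)) () = some (φ, (), .left, .stay, o a))
    (u : List α) {l r : List (Option (A ⊕ Bool))} {out : List (Option A)} {i j : ℕ}
    (hs : s = l ++ (u.map g ++ r)) (hi : i = l.length + u.length) (hj : j = l.length) :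
    StateTransition.Reaches ((pairTransducer p q).step s) (cfg p q φ i out)
      (cfg p q φ j (out ++ u.reverse.flatMap o)) := by
  induction u using List.reverseRecOn generalizing r out i with
  | nil =>
    obtain rfl : i = j := by simp [hi, hj]
    rw [List.reverse_nil, List.flatMap_nil, List.append_nil]
    exact .refl
  | append_singleton u a ih =>
    have h₁ := step_cfg p q (s := s) (o := out) (i := i) (j := l.length + u.length)
      (by
        rw [readInput_letter (c := g a) (l := l ++ u.map g) (r := r) (by simp [hs])
          (by simp [hi]; omega)]
        exact hφ a)
      (by simp [Move.apply, hi, hs]; omega)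
    have h₂ := ih (r := g a :: r) (out := out ++ o a) (i := l.length + u.length) (by simp [hs]) rfl
    have h : StateTransition.Reaches _ _ _ := h₁.trans h₂
    simpa using h

theorem init_reaches : StateTransition.Reaches ((pairTransducer p q).step s)
    (pairTransducer p q).init (cfg p q .copyWord 1 []) :=
  step_cfg p q (s := s) (φ := .start) (i := 0) (o := []) (o' := []) rfl (by simp [Move.apply])

theorem reaches_pushX {w : List A} {t : List (Option (A ⊕ Bool))}
    (hs : s = w.map (fun c => some (Sum.inl c)) ++ none :: t) :
    StateTransition.Reaches ((pairTransducer p q).step s)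
      (pairTransducer p q).init (cfg p q .pushX (w.length + 2) (w.map some)) := by
  have h₁ := scan_right p q (s := s) (φ := .copyWord) (o := fun a => [some a]) (fun _ => rfl) w
    (l := []) (out := []) (i := 1) hs rfl rfl
  have h₂ := step_cfg p q (s := s) (φ := .copyWord) (φ' := .pushX) (mv := .right)
    (i := w.length + 1) (j := w.length + 2) (o := w.map some) (o' := [])
    (by rw [readInput_letter hs (by simp)]; rfl) (by simp [Move.apply, hs])
  simp only [List.length_nil, zero_add, List.nil_append, List.append_nil,
    ← List.map_eq_flatMap] at h₁ h₂
  exact ((init_reaches p q).trans h₁).trans h₂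

theorem flatMap_nil_fun {α β : Type} (l : List α) : l.flatMap (fun _ => ([] : List β)) = [] := by
  simp

theorem reaches_pushY {w : List A} {x : List Bool} {t : List (Option (A ⊕ Bool))}
    (hs : s = w.map (fun c => some (Sum.inl c)) ++
      none :: (x.map (fun c => some (Sum.inr c)) ++ none :: t)) :
    StateTransition.Reaches ((pairTransducer p q).step s) (pairTransducer p q).init
      (cfg p q .pushY (w.length + x.length + 3)
        ((w ++ (x.flatMap p ++ x.reverse.flatMap q)).map some ++ [none])) := by
  have hs' : s = (w.map (fun c => some (Sum.inl c)) ++ [none]) ++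
      (x.map (fun c => some (Sum.inr c)) ++ none :: t) := by simp [hs]
  have h₁ := reaches_pushX p q hs
  have h₂ := scan_right p q (s := s) (φ := .pushX) (o := fun b => (p b).map some) (fun b => rfl) x
    (out := w.map some) (i := w.length + 2) (j := w.length + x.length + 2) hs' (by simp)
    (by simp; omega)
  have h₃ := step_cfg p q (s := s) (φ := .pushX) (φ' := .popX) (mv := .left)
    (i := w.length + x.length + 2) (j := w.length + x.length + 1)
    (o := w.map some ++ x.flatMap fun b => (p b).map some) (o' := [])
    (by
      rw [readInput_letter (c := none) (r := t) (hs'.trans (List.append_assoc _ _ _).symm)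
        (by simp; omega)]
      rfl)
    (by simp [Move.apply, hs]; omega)
  have h₄ := scan_left p q (s := s) (φ := .popX) (o := fun b => (q b).map some) (fun b => rfl) x
    (out := w.map some ++ (x.flatMap fun b => (p b).map some) ++ [])
    (i := w.length + x.length + 1) (j := w.length + 1) hs' (by simp; omega) (by simp)
  have h₅ := fun o => step_cfg p q (s := s) (φ := .popX) (φ' := .skipX) (mv := .right)
    (i := w.length + 1) (j := w.length + 2) (o := o) (o' := [none])
    (by rw [readInput_letter hs (by simp)]; rfl) (by simp [Move.apply, hs])
  have h₆ := fun o => scan_right p q (s := s) (φ := .skipX) (o := fun _ => []) (fun b => rfl) x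
    (out := o) (i := w.length + 2) (j := w.length + x.length + 2) hs' (by simp) (by simp; omega)
  have h₇ := fun o => step_cfg p q (s := s) (φ := .skipX) (φ' := .pushY) (mv := .right)
    (i := w.length + x.length + 2) (j := w.length + x.length + 3) (o := o) (o' := [])
    (by
      rw [readInput_letter (c := none) (r := t) (hs'.trans (List.append_assoc _ _ _).symm)
        (by simp; omega)]
      rfl)
    (by simp [Move.apply, hs]; omega)
  have h : StateTransition.Reaches _ _ _ :=
    (((((h₁.trans h₂).trans h₃).trans h₄).trans (h₅ _)).trans (h₆ _)).trans (h₇ _)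
  simpa [List.map_flatMap, flatMap_nil_fun] using h

theorem reaches_end (w : List A) (x y : List Bool) (hs : s = rawTriple w x y) :
    ∃ i, StateTransition.Reaches ((pairTransducer p q).step s) (pairTransducer p q).init
      (cfg p q .popLast i (rawPair p q w x y)) ∧ readInput s i = .letter none := by
  have hx : s = (w.map (fun c => some (Sum.inl c)) ++ [none]) ++
      (x.map (fun c => some (Sum.inr c)) ++ none :: y.map (fun c => some (Sum.inr c))) := by
    simp [hs, rawTriple]
  have hy : s = (w.map (fun c => some (Sum.inl c)) ++
      none :: (x.map (fun c => some (Sum.inr c)) ++ [none])) ++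
      (y.map (fun c => some (Sum.inr c)) ++ []) := by
    simp [hs, rawTriple]
  refine ⟨w.length + 1, ?_, readInput_letter hs (by simp)⟩
  have h₁ := reaches_pushY p q hs
  have h₂ := fun o => scan_right p q (s := s) (φ := .pushY) (o := fun b => (p b).map some)
    (fun b => rfl) y (out := o) (i := w.length + x.length + 3)
    (j := w.length + x.length + y.length + 3) hy (by simp; omega) (by simp; omega)
  have hlen : w.length + x.length + y.length + 3 = s.length + 1 := by
    simp [hs, rawTriple]; omega
  have h₃ := fun o => step_cfg p q (s := s) (φ := .pushY) (φ' := .skipY) (mv := .left)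
    (i := w.length + x.length + y.length + 3) (j := w.length + x.length + y.length + 2)
    (o := o) (o' := []) (by rw [readInput_end hlen]; rfl) (by simp [Move.apply]; omega)
  have h₄ := fun o => scan_left p q (s := s) (φ := .skipY) (o := fun _ => []) (fun b => rfl) y
    (out := o) (i := w.length + x.length + y.length + 2) (j := w.length + x.length + 2) hy
    (by simp; omega) (by simp; omega)
  have h₅ := fun o => step_cfg p q (s := s) (φ := .skipY) (φ' := .popLast) (mv := .left)
    (i := w.length + x.length + 2) (j := w.length + x.length + 1) (o := o) (o' := [])
    (by
      rw [readInput_letter (c := none) (hx.trans (List.append_assoc _ _ _).symm)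
        (by simp; omega)]
      rfl)
    (by simp [Move.apply]; omega)
  have h₆ := fun o => scan_left p q (s := s) (φ := .popLast) (o := fun b => (q b).map some)
    (fun b => rfl) x (out := o) (i := w.length + x.length + 1) (j := w.length + 1) hx
    (by simp; omega) (by simp)
  have h : StateTransition.Reaches _ _ _ :=
    ((((h₁.trans (h₂ _)).trans (h₃ _)).trans (h₄ _)).trans (h₅ _)).trans (h₆ _)
  simpa [rawPair, List.map_flatMap, flatMap_nil_fun] using h

end pairTransducer

/-- The longest prefix of `t` whose letters are values of `g`. -/
theorem exists_map_append {α β : Type} (g : α → β) (t : List β) :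
    ∃ u r, t = List.map g u ++ r ∧ ∀ c ∈ r.head?, c ∉ Set.range g := by
  induction t with
  | nil => exact ⟨[], [], rfl, by simp⟩
  | cons c t ih =>
    by_cases hc : c ∈ Set.range g
    · obtain ⟨a, rfl⟩ := hc
      obtain ⟨u, r, rfl, hr⟩ := ih
      exact ⟨a :: u, r, rfl, hr⟩
    · exact ⟨[], c :: t, rfl, by simpa using hc⟩

open pairTransducer in
/-- On every input the transducer halts, and its output is the image of the triple if the input is
well-formed, and ends with two separators otherwise. -/
theorem pairTransducer_halts (p q : Bool → List A) (s : List (Option (A ⊕ Bool))) :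
    ∃ c : Config (pairTransducer p q),
      StateTransition.Reaches ((pairTransducer p q).step s) (pairTransducer p q).init c ∧
      (pairTransducer p q).step s c = none ∧
      ((∃ w x y, s = rawTriple w x y ∧ c.output = rawPair p q w x y) ∨
        ((¬ ∃ w x y, s = rawTriple w x y) ∧ ∃ t, c.output = t ++ [none, none])) := by
  by_cases hwf : ∃ w x y, s = rawTriple w x y
  · obtain ⟨w, x, y, hs⟩ := hwf
    obtain ⟨i, hi, hr⟩ := reaches_end p q w x y hs
    refine ⟨_, hi, ?_, .inl ⟨w, x, y, hs, rfl⟩⟩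
    simp [Transducer.step, cfg, hr, pairTransducer]
  -- It suffices to reach a configuration from which the machine goes into the phase `halt`.
  suffices h : ∃ φ i o, StateTransition.Reaches ((pairTransducer p q).step s)
      (pairTransducer p q).init (cfg p q φ i o) ∧ i ≤ s.length + 1 ∧
      (pairTransducer p q).trans φ (readInput s i) () =
        some (.halt, (), .stay, .stay, [none, none]) by
    obtain ⟨φ, i, o, hreach, hi, ht⟩ := h
    exact ⟨_, hreach.trans (step_cfg p q ht (min_eq_left hi)), rfl, .inr ⟨hwf, o, rfl⟩⟩
  obtain ⟨w, r, hs, hr₁⟩ := exists_map_append (fun c : A => (some (Sum.inl c) : Option (A ⊕ Bool))) s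
  have hw := (init_reaches p q).trans (scan_right p q (s := s) (φ := .copyWord)
    (o := fun a => [some a]) (fun a => rfl) w (l := []) (out := []) (i := 1) hs rfl rfl)
  match r with
  | [] =>
    refine ⟨_, _, _, hw, by simp [hs], ?_⟩
    rw [readInput_end (by simp [hs])]
    rfl
  | some (.inl a) :: r => exact absurd ⟨a, rfl⟩ (hr₁ _ rfl)
  | some (.inr b) :: r =>
    refine ⟨_, _, _, hw, by simp [hs], ?_⟩
    rw [readInput_letter hs (by simp)]
    rfl
  | none :: r =>
    obtain ⟨x, r, rfl, hr₂⟩ :=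
      exists_map_append (fun c : Bool => (some (Sum.inr c) : Option (A ⊕ Bool))) r
    have hs' : s = (w.map (fun c => some (Sum.inl c)) ++ [none]) ++
        (x.map (fun c => some (Sum.inr c)) ++ r) := by simp [hs]
    have hx := (reaches_pushX p q hs).trans (scan_right p q (s := s) (φ := .pushX)
      (o := fun b => (p b).map some) (fun b => rfl) x hs' (by simp) rfl)
    match r with
    | [] =>
      refine ⟨_, _, _, hx, by simp [hs]; omega, ?_⟩
      rw [readInput_end (by simp [hs]; omega)]
      rfl
    | some (.inr b) :: r => exact absurd ⟨b, rfl⟩ (hr₂ _ rfl)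
    | some (.inl b) :: r =>
      refine ⟨_, _, _, hx, by simp [hs]; omega, ?_⟩
      rw [readInput_letter (hs'.trans (List.append_assoc _ _ _).symm) (by simp; omega)]
      rfl
    | none :: r =>
      obtain ⟨y, r, rfl, hr₃⟩ :=
        exists_map_append (fun c : Bool => (some (Sum.inr c) : Option (A ⊕ Bool))) r
      have hs'' : s = (w.map (fun c => some (Sum.inl c)) ++
          none :: (x.map (fun c => some (Sum.inr c)) ++ [none])) ++
          (y.map (fun c => some (Sum.inr c)) ++ r) := by
        simp [hs]
      have hy := (reaches_pushY p q hs).trans (scan_right p q (s := s) (φ := .pushY)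
        (o := fun b => (p b).map some) (fun b => rfl) y hs'' (by simp; omega) rfl)
      match r with
      | [] => exact absurd ⟨w, x, y, by simp [hs, rawTriple]⟩ hwf
      | some (.inr b) :: r => exact absurd ⟨b, rfl⟩ (hr₃ _ rfl)
      | some (.inl b) :: r =>
        refine ⟨_, _, _, hy, by simp [hs]; omega, ?_⟩
        rw [readInput_letter (hs''.trans (List.append_assoc _ _ _).symm) (by simp; omega)]
        rfl
      | none :: r =>
        refine ⟨_, _, _, hy, by simp [hs]; omega, ?_⟩
        rw [readInput_letter (hs''.trans (List.append_assoc _ _ _).symm) (by simp; omega)]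
        rfl

/-- The evaluation problem reduces to the word problem whenever the letters generate `M_{2,1}` and
are encoded by a suffix code. -/
theorem evaluationProblem_reducible {L : Type} [Finite A] {val : L → M21} {enc : L → List A}
    (henc : IsSuffixCode enc) (hval : ∀ m, ∃ w, evalWord val w = m) :
    ManyOneLogSpaceReducible (evaluationProblem val enc) (wordProblem val enc) := by
  choose P hP using fun b : Bool => hval (replacePrefix [b] [])
  choose Q hQ using fun b : Bool => hval (replacePrefix [] [b])
  choose c hreach hhalt hout using
    pairTransducer_halts (fun b => encodeWord enc (P b)) (fun b => encodeWord enc (Q b))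
  refine ⟨fun s => (c s).output, ⟨_, fun s => ⟨c s, hreach s, hhalt s, rfl⟩,
    pairTransducer.usesLogSpace _ _⟩, fun s => ?_⟩
  change s ∈ _ ↔ (c s).output ∈ _
  rcases hout s with ⟨w, x, y, hs, ho⟩ | ⟨hs, t, ht⟩
  · rw [ho, hs]
    exact rawTriple_mem_iff henc hP hQ w x y
  · rw [ht]
    refine iff_of_false ?_ (not_mem_wordProblem t)
    rintro ⟨w, x, y, h, -⟩
    exact hs ⟨_, x, y, h⟩

end LogSpace

namespace ThompsonMonoid

/-! ### Words over generating sets -/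

theorem exists_evalWord_gammaVal {Γ : Set M21} (hΓ : Submonoid.closure Γ = ⊤) (m : M21) :
    ∃ w, evalWord (gammaVal Γ) w = m := by
  have hm : m ∈ Submonoid.closure Γ := hΓ ▸ Submonoid.mem_top m
  induction hm using Submonoid.closure_induction with
  | mem g hg => exact ⟨[⟨g, hg⟩], by simp [evalWord, gammaVal]⟩
  | one => exact ⟨[], rfl⟩
  | mul g h _ _ ihg ihh =>
    obtain ⟨u, rfl⟩ := ihg
    obtain ⟨v, rfl⟩ := ihh
    exact ⟨u ++ v, evalWord_append _ u v⟩

theorem exists_evalWord_gammaTauVal {Γ : Set M21} (hΓ : Submonoid.closure Γ = ⊤) (m : M21) :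
    ∃ w, evalWord (gammaTauVal Γ) w = m := by
  obtain ⟨w, rfl⟩ := exists_evalWord_gammaVal hΓ m
  refine ⟨w.map Sum.inl, ?_⟩
  rw [evalWord, List.map_map]
  rfl

end ThompsonMonoid

open ThompsonMonoid LogSpace in
theorem proposition7p1 (Γ : Set M21) [Finite Γ] (hΓ : Submonoid.closure Γ = ⊤) :
    (∀ (g : M21) (x y : List Bool),
      g.eval x = some y ↔ g * replacePrefix x x = replacePrefix y x) ∧
    ManyOneLogSpaceReducible (evaluationProblem (gammaVal Γ) (gammaEnc Γ))
      (wordProblem (gammaVal Γ) (gammaEnc Γ)) ∧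
    ManyOneLogSpaceReducible (evaluationProblem (gammaTauVal Γ) (gammaTauEnc Γ))
      (wordProblem (gammaTauVal Γ) (gammaTauEnc Γ)) :=
  ⟨eval_eq_some_iff,
    evaluationProblem_reducible (isSuffixCode_gammaEnc Γ) (exists_evalWord_gammaVal hΓ),
    evaluationProblem_reducible (isSuffixCode_gammaTauEnc Γ) (exists_evalWord_gammaTauVal hΓ)⟩
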